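/- **Setting.** Let $\mathbb{F}_q$ be a finite field and let $A(Y),B(X)$ be univariate polynomials over $\mathbb{F}_q$ of positive coprime degrees $a=\deg A$, $b=\deg B$ such that $A(Y)-B(X)$ is absolutely irreducible. Let $\mathcal{X}$ be the non-singular projective model of the curve $A(Y)=B(X)$, with function field $\mathbb{F}_q(\mathcal X)$ generated by the coordinate functions $x,y$, and let $Q$ be the common pole of $x$ and $y$. Write $\mathcal{L}(mQ)$ for the Riemann space of the divisor $mQ$, and $H(Q)$ for the Weierstrass semigroup at $Q$, i.e. the set of pole orders at $Q$ of the non-zero rational functions without poles outside $Q$. Let $\mathcal{U}$ be the set of $\beta\in\mathbb{F}_q$ such that the fibre $y^{-1}(\beta)$ consists of $b$ distinct rational points, $\mathcal{P}=\bigcup_{\beta\in\mathcal{U}}y^{-1}(\beta)$, and $n=\#\mathcal{P}$. For a space $W$ of functions regular on $\mathcal P$ let $\mathcal{C}(\mathcal{P},W)=\{(f(P))_{P\in\mathcal{P}} : f\in W\}$. For a linear code $\mathcal{C}$ let $d_t(\mathcal{C})$ be its $t$-th generalized Hamming weight, i.e. the smallest support size of a $t$-dimensional linear subcode of $\mathcal{C}$.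 For an integer $m\ge 0$ define the complete space $$V_m=\mathcal{L}(mQ)\cap\bigoplus_{i=0}^{b-2}\mathbb{F}_q[y]\,x^i .$$ **Proposition.** Let $m\ge 0$ be an integer with $m<n$, let $V=V_m$, and assume $H(Q)=\langle a,b\rangle$ (the semigroup of all $\lambda a+\mu b$ with integers $\lambda,\mu\ge 0$). Then for every $t=1,\dots,k=\dim\mathcal{C}(\mathcal{P},V)$: (a) if $m<a(b-1)$, then $d_t(\mathcal{C}(\mathcal{P},V))=d_t(\mathcal{C}(\mathcal{P},\mathcal{L}(mQ)))$; (b) if $m\ge a(b-1)$, then $$d_t(\mathcal{C}(\mathcal{P},\mathcal{L}(mQ)))\le d_t(\mathcal{C}(\mathcal{P},V))\le d_{t+\ell_{b-1}+1}(\mathcal{C}(\mathcal{P},\mathcal{L}(mQ))),\qquad \ell_{b-1}=\left\lfloor\frac{m-a(b-1)}{b}\right\rfloor .$$ -/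

import Mathlib

open Polynomial

noncomputable section

namespace SepCurve

/-! ### Places, divisors and Riemann spaces of an extension `K / F` -/

section Places

variable (F K : Type*) [Field F] [Field K] [Algebra F K]

/-- A place of `K / F` (a closed point of the non-singular projective model when `K` is the
function field of a curve over `F`): a discrete valuation ring of `K` that contains `F`. -/
@[ext]
structure Place where
  toValuationSubring : ValuationSubring K
  algebraMap_mem : ∀ c : F, algebraMap F K c ∈ toValuationSubring
  isDVR : IsDiscreteValuationRing toValuationSubring

variable {F K}

namespace Place

/-- The multiplicative valuation of a place, normalised so that a uniformizer has value
`exp (-1)`. -/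
def val (P : Place F K) : Valuation K (WithZero (Multiplicative ℤ)) :=
  haveI := P.isDVR
  (IsDiscreteValuationRing.maximalIdeal P.toValuationSubring).valuation K

/-- The pole order of a function at a place, i.e. minus the order of vanishing
(only meaningful for `f ≠ 0`). -/
def poleOrder (P : Place F K) (f : K) : ℤ := WithZero.log (P.val f)

/-- `P` is a pole of `f`. -/
def IsPole (P : Place F K) (f : K) : Prop := 1 < P.val f

/-- `f` is regular at `P` and takes there the value `c ∈ F`, i.e. `f - c` vanishes at `P`. -/
def HasValue (P : Place F K) (f : K) (c : F) : Prop := P.val (f - algebraMap F K c) < 1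

/-- `P` is rational: its residue field is `F`, i.e. each function that is regular at `P` is
congruent to a constant of `F` modulo the maximal ideal of `P`. -/
def IsRational (P : Place F K) : Prop := ∀ f : K, P.val f ≤ 1 → ∃ c : F, P.HasValue f c

lemma val_algebraMap_le_one (P : Place F K) (c : F) : P.val (algebraMap F K c) ≤ 1 := by
  have := P.isDVR
  exact (IsDiscreteValuationRing.maximalIdeal P.toValuationSubring).valuation_le_one
    (⟨algebraMap F K c, P.algebraMap_mem c⟩ : P.toValuationSubring)

lemma val_smul_le (P : Place F K) (c : F) (f : K) : P.val (c • f) ≤ P.val f := by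
  rw [Algebra.smul_def, map_mul]
  exact mul_le_of_le_one_left' (P.val_algebraMap_le_one c)

/-- The value of a function at a place is unique. -/
lemma HasValue.unique {P : Place F K} {f : K} {c d : F} (hc : P.HasValue f c)
    (hd : P.HasValue f d) : c = d := by
  by_contra hne
  have h0 : d - c ≠ 0 := sub_ne_zero.mpr (Ne.symm hne)
  have h1 : P.val (algebraMap F K (d - c)) < 1 := by
    have h := P.val.map_sub_lt hc hd
    rwa [sub_sub_sub_cancel_left, ← map_sub] at h
  have h2 := P.val_algebraMap_le_one (d - c)⁻¹
  have h3 : P.val (algebraMap F K (d - c)⁻¹) * P.val (algebraMap F K (d - c)) = 1 := by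
    rw [← map_mul, ← map_mul, inv_mul_cancel₀ h0, map_one, map_one]
  have h4 := mul_lt_mul_of_le_of_lt_of_nonneg_of_pos h2 h1 zero_le zero_lt_one
  rw [h3, one_mul] at h4
  exact lt_irrefl _ h4

end Place

/-- A divisor: a finite formal `ℤ`-linear combination of places. -/
abbrev Divisor (F K : Type*) [Field F] [Field K] [Algebra F K] := Place F K →₀ ℤ

/-- The Riemann space `𝓛(G)`: the functions `f` with `f = 0` or `div f + G ≥ 0`. -/
def riemannSpace (G : Divisor F K) : Submodule F K where
  carrier := {f | ∀ P : Place F K, P.val f ≤ WithZero.exp (G P)}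
  zero_mem' := fun P => by simp
  add_mem' := fun {f g} hf hg P => (P.val.map_add f g).trans (max_le (hf P) (hg P))
  smul_mem' := fun c f hf P => (P.val_smul_le c f).trans (hf P)

/-- The Weierstrass semigroup `H(Q)`: the pole orders at `Q` of the functions that have no pole
outside `Q`. -/
def weierstrassSemigroup (Q : Place F K) : Set ℕ :=
  {h | ∃ f : K, f ≠ 0 ∧ (∀ P : Place F K, P ≠ Q → ¬ P.IsPole f) ∧ Q.poleOrder f = h}

/-- The evaluation code `C(S, V) = ev_S(V)`, with coordinates indexed by the set of places `S`:
the words `(f(P))_{P ∈ S}` with `f ∈ V`. -/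
def evalCode (S : Set (Place F K)) (V : Submodule F K) : Submodule F (S → F) where
  carrier := {w | ∃ f ∈ V, ∀ P : S, P.1.HasValue f (w P)}
  zero_mem' := ⟨0, V.zero_mem, fun P => by simp [Place.HasValue]⟩
  add_mem' := by
    rintro u w ⟨f, hf, hfu⟩ ⟨g, hg, hgw⟩
    refine ⟨f + g, V.add_mem hf hg, fun P => ?_⟩
    have h := P.1.val.map_add_lt (hfu P) (hgw P)
    rwa [sub_add_sub_comm, ← map_add] at h
  smul_mem' := by
    rintro c w ⟨f, hf, hfw⟩
    refine ⟨c • f, V.smul_mem c hf, fun P => ?_⟩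
    have h := (P.1.val_smul_le c (f - algebraMap F K (w P))).trans_lt (hfw P)
    rwa [smul_sub, ← algebraMap.coe_smul] at h

end Places

/-! ### Generalized Hamming weights -/

section Weights

variable {F ι : Type*} [Field F]

/-- The support of a linear code: the coordinates at which some codeword does not vanish. -/
def codeSupport (E : Submodule F (ι → F)) : Set ι := {i | ∃ v ∈ E, v i ≠ 0}

/-- The `t`-th generalized Hamming weight of the code `C`: the least support size of a
`t`-dimensional subcode. -/
def genHammingWeight (C : Submodule F (ι → F)) (t : ℕ) : ℕ :=
  sInf {s | ∃ E : Submodule F (ι → F), E ≤ C ∧ Module.finrank F E = t ∧ (codeSupport E).ncard = s}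

end Weights

/-! ### The curve `A(Y) = B(X)` -/

section Curve

variable {F : Type*} [Field F] (A B : F[X])

/-- The polynomial `A(Y) - B(X)`, as a polynomial in `Y` over `F[X]`. -/
def sepPoly : F[X][X] := A.map C - C B

/-- `A(Y) - B(X)` is absolutely irreducible, i.e. irreducible over the algebraic closure. -/
def AbsIrreducible : Prop :=
  Irreducible ((sepPoly A B).map (mapRingHom (algebraMap F (AlgebraicClosure F))))

/-- The affine coordinate ring `F[X, Y] / (A(Y) - B(X))`. -/
abbrev CoordRing := AdjoinRoot (sepPoly A B)

lemma isLocalHom_mapRingHom {R S : Type*} [CommRing R] [IsDomain R] [CommRing S] [IsDomain S]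
    (φ : R →+* S) (hφ : Function.Injective φ) [IsLocalHom φ] : IsLocalHom (mapRingHom φ) where
  map_nonunit p hp := by
    obtain ⟨s, hs, hsp⟩ := Polynomial.isUnit_iff.mp hp
    rw [coe_mapRingHom] at hsp
    have hdeg : p.natDegree = 0 := by
      rw [← natDegree_map_eq_of_injective hφ p, ← hsp, natDegree_C]
    obtain ⟨r, rfl⟩ := natDegree_eq_zero.mp hdeg
    rw [map_C, C_inj] at hsp
    exact (isUnit_of_map_unit φ r (hsp ▸ hs)).map C

instance [h : Fact (AbsIrreducible A B)] : IsDomain (CoordRing A B) := by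
  have h1 : Irreducible (mapRingHom (mapRingHom (algebraMap F (AlgebraicClosure F)))
      (sepPoly A B)) := h.out
  have := isLocalHom_mapRingHom (algebraMap F (AlgebraicClosure F)) (RingHom.injective _)
  have := isLocalHom_mapRingHom (mapRingHom (algebraMap F (AlgebraicClosure F)))
    (map_injective _ (RingHom.injective _))
  have h2 : Irreducible (sepPoly A B) := Irreducible.of_map h1
  exact AdjoinRoot.isDomain_of_prime h2.prime

/-- The function field `F(𝒳)` of the curve `A(Y) = B(X)`. -/
abbrev FunctionField := FractionRing (CoordRing A B)

/-- The function `x` on the curve, the coset of `X`. -/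
def xFun : FunctionField A B := algebraMap (CoordRing A B) _ (AdjoinRoot.of (sepPoly A B) X)

/-- The function `y` on the curve, the coset of `Y`. -/
def yFun : FunctionField A B := algebraMap (CoordRing A B) _ (AdjoinRoot.root (sepPoly A B))

variable [Fact (AbsIrreducible A B)]

/-- The points of the curve in the fibre of the function `y` over `β`. -/
def yFibre (β : F) : Set (Place F (FunctionField A B)) := {P | P.HasValue (yFun A B) β}

/-- The set `𝒰` of all `β ∈ F` whose fibre `y⁻¹(β)` is totally split, i.e. consists of
`b = deg B` distinct rational points. -/
def splitValues : Set F :=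
  {β | (yFibre A B β).ncard = B.natDegree ∧ ∀ P ∈ yFibre A B β, P.IsRational}

/-- The evaluation set `𝒫`, the union of all totally split fibres of `y`. -/
def evalPoints : Set (Place F (FunctionField A B)) := ⋃ β ∈ splitValues A B, yFibre A B β

/-- The space `⊕_{i=0}^{b-2} F[y] x^i`, where `b = deg B` (the zero space if `b = 1`). -/
def polySpace : Submodule F (FunctionField A B) :=
  ⨆ i ∈ Finset.range (B.natDegree - 1),
    (Subalgebra.toSubmodule (Algebra.adjoin F {yFun A B})).map
      (LinearMap.mulRight F (xFun A B ^ i))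

/-- The complete space `V_m = 𝓛(mQ) ∩ ⊕_{i=0}^{b-2} F[y] x^i`. -/
def completeSpace (Q : Place F (FunctionField A B)) (m : ℕ) : Submodule F (FunctionField A B) :=
  riemannSpace (Finsupp.single Q (m : ℤ)) ⊓ polySpace A B

end Curve

end SepCurve

end

/-! At a common pole of `x` and `y`, comparing leading terms in `A(y) = B(x)` gives pole orders `a *
e` and `b * e`. The monomials `x ^ i * y ^ j` with `i < b` span the coordinate ring `R`, and
coprimality makes their weights `a * i + b * j` distinct. Hence no cancellation occurs at such a
pole, every valuation there is a multiple of `e`, and so `e = 1`; the same computation shows that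
`Q` is the only such pole.

The hypothesis `H(Q) = ⟨a, b⟩` makes `R` normal: a function integral over `R` has poles only at `Q`,
its pole order is that of some monomial, and subtracting a multiple of that monomial lowers the
order (`exists_eq_of_isIntegral`). So `R` is Dedekind, it consists of all functions regular outside
`Q`, and `𝓛(mQ)` has as basis the monomials of weight at most `m` (`riemannSpace_eq_span`). `V` is
spanned by those with `i < b - 1`. For `m < a(b-1)` nothing is lost; otherwise exactly the `ℓ_{b-1}
+ 1` monomials with `i = b - 1` are.

Since `m < n`, evaluation is injective on `𝓛(mQ)`. The bound on zeros comes from a dimension count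
(`ncard_le_of_evalMap_eq_zero`): evaluation on `R` is onto by the Chinese remainder theorem, and
multiplication by a function vanishing on all points embeds `𝓛(NQ)` in the kernel of evaluation on
`𝓛((N+m)Q)`. Thus the two codes differ by `ℓ_{b-1} + 1` in dimension, and intersecting subcodes with
the smaller code gives the upper bound. -/

noncomputable section

namespace SepCurve

/-! ### Valuations at places -/

section Places

variable {F K : Type*} [Field F] [Field K] [Algebra F K]

namespace Place

lemma val_le_one_iff (P : Place F K) (f : K) : P.val f ≤ 1 ↔ f ∈ P.toValuationSubring := by
  have := P.isDVR
  constructor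
  · intro h
    obtain ⟨a, rfl⟩ := IsDiscreteValuationRing.exists_lift_of_le_one
      (A := P.toValuationSubring) (K := K) h
    exact a.2
  · intro h
    exact (IsDiscreteValuationRing.maximalIdeal P.toValuationSubring).valuation_le_one
      (⟨f, h⟩ : P.toValuationSubring)

lemma val_algebraMap_eq_one (P : Place F K) {c : F} (hc : c ≠ 0) :
    P.val (algebraMap F K c) = 1 := by
  refine le_antisymm (P.val_algebraMap_le_one c) ?_
  have h := P.val_algebraMap_le_one c⁻¹
  rw [map_inv₀, map_inv₀] at h
  exact (inv_le_one₀ (by simpa [zero_lt_iff] using hc)).mp h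

lemma val_smul_eq (P : Place F K) {c : F} (hc : c ≠ 0) (f : K) : P.val (c • f) = P.val f := by
  rw [Algebra.smul_def, map_mul, P.val_algebraMap_eq_one hc, one_mul]

lemma exists_val_eq_exp_one (P : Place F K) : ∃ f : K, P.val f = WithZero.exp (1 : ℤ) := by
  have := P.isDVR
  exact (IsDiscreteValuationRing.maximalIdeal P.toValuationSubring).valuation_surjective K _

lemma eq_of_val_le_one_imp {P P' : Place F K} (h : ∀ f, P.val f ≤ 1 ↔ P'.val f ≤ 1) :
    P = P' := by
  apply Place.ext
  ext f
  rw [← val_le_one_iff, ← val_le_one_iff, h]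

lemma val_le_one_of_isIntegral (P : Place F K) {R : Type*} [CommRing R] [Algebra R K]
    (hR : ∀ r : R, P.val (algebraMap R K r) ≤ 1) {f : K} (hf : IsIntegral R f) :
    P.val f ≤ 1 := by
  have := P.isDVR
  rw [val_le_one_iff]
  have h1 : IsIntegral P.toValuationSubring f := by
    obtain ⟨p, hp, hpf⟩ := hf
    let φ : R →+* P.toValuationSubring := (algebraMap R K).codRestrict P.toValuationSubring
      fun r => (P.val_le_one_iff _).mp (hR r)
    refine ⟨p.map φ, hp.map φ, ?_⟩
    rw [eval₂_map]
    exact hpf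
  obtain ⟨g, hg⟩ := IsIntegrallyClosed.isIntegral_iff.mp h1
  rw [← hg]
  exact g.2

/-- The leading term of a polynomial dominates at a pole. -/
lemma val_aeval_eq (P : Place F K) {f : K} (hf : 1 < P.val f) {p : F[X]} (hp : p ≠ 0) :
    P.val (aeval f p) = P.val f ^ p.natDegree := by
  classical
  rw [aeval_eq_sum_range]
  have hn : p.natDegree ∈ Finset.range (p.natDegree + 1) := by simp
  rw [P.val.map_sum_eq_of_lt hn, val_smul_eq _ (by simpa using hp), map_pow]
  · intro i hi
    have hi' : i < p.natDegree := by
      simp only [Finset.mem_sdiff, Finset.mem_range, Finset.mem_singleton] at hi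
      omega
    rw [val_smul_eq _ (c := p.coeff p.natDegree) (by simpa using hp)]
    refine (P.val_smul_le _ _).trans_lt ?_
    rw [map_pow, map_pow]
    exact pow_lt_pow_right₀ hf hi'

lemma val_aeval_le_one (P : Place F K) {f : K} (hf : P.val f ≤ 1) (p : F[X]) :
    P.val (aeval f p) ≤ 1 := by
  rw [aeval_eq_sum_range]
  refine P.val.map_sum_le fun i _ => (P.val_smul_le _ _).trans ?_
  rw [map_pow]
  exact pow_le_one' hf i

end Place

end Places

/-! ### The coordinate ring: monomial generators and integrality over `F[X]` -/

section Curve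

variable {F : Type*} [Field F] (A B : F[X])

/-- The coordinate function `x` in the coordinate ring. -/
def xCoord : CoordRing A B := AdjoinRoot.of (sepPoly A B) X

/-- The coordinate function `y` in the coordinate ring. -/
def yCoord : CoordRing A B := AdjoinRoot.root (sepPoly A B)

lemma aeval_xCoord (p : F[X]) : aeval (xCoord A B) p = AdjoinRoot.of (sepPoly A B) p := by
  have h := (aeval_algHom_apply (IsScalarTower.toAlgHom F F[X] (CoordRing A B)) X p)
  rw [aeval_X_left_apply] at h
  exact h

lemma aeval_yCoord_eq_aeval_xCoord : aeval (yCoord A B) A = aeval (xCoord A B) B := by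
  have h := AdjoinRoot.eval₂_root (sepPoly A B)
  rw [sepPoly, eval₂_sub, eval₂_C, sub_eq_zero, eval₂_map] at h
  rw [aeval_xCoord]
  exact h

/-- The monomial `x ^ i * y ^ j` in the coordinate ring, where `i < b`. -/
def mono (b : ℕ) (k : Fin b × ℕ) : CoordRing A B := xCoord A B ^ (k.1 : ℕ) * yCoord A B ^ k.2

lemma coordRing_induction {N : Submodule F (CoordRing A B)} (h1 : 1 ∈ N)
    (hx : ∀ r ∈ N, xCoord A B * r ∈ N) (hy : ∀ r ∈ N, yCoord A B * r ∈ N)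
    (r : CoordRing A B) : r ∈ N := by
  have hxp (p : F[X]) (r) (hr : r ∈ N) : aeval (xCoord A B) p * r ∈ N := by
    induction p using Polynomial.induction_on' with
    | add p q hp hq => rw [map_add, add_mul]; exact N.add_mem hp hq
    | monomial n c =>
      rw [aeval_monomial, mul_assoc, ← Algebra.smul_def]
      refine N.smul_mem c ?_
      induction n with
      | zero => simpa using hr
      | succ n ih => rw [pow_succ', mul_assoc]; exact hx _ ih
  induction r using AdjoinRoot.induction_on with
  | ih p =>
    induction p using Polynomial.induction_on' with
    | add p q hp hq => rw [map_add]; exact N.add_mem hp hq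
    | monomial n c =>
      rw [← C_mul_X_pow_eq_monomial, map_mul, map_pow, AdjoinRoot.mk_X]
      have : (AdjoinRoot.mk (sepPoly A B)) (C c) = aeval (xCoord A B) c := by
        rw [aeval_xCoord]; rfl
      rw [this]
      apply hxp
      induction n with
      | zero => simpa using h1
      | succ n ih => rw [pow_succ']; exact hy _ ih

/-- The leading coefficient of `B` is invertible, so the curve equation rewrites `x ^ b` through
lower powers of `x` and a polynomial in `y`; the span is therefore stable under multiplication by
`x` and `y`. -/
lemma span_mono {b : ℕ} (hb : B.natDegree = b) (hb0 : 0 < b) :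
    Submodule.span F (Set.range (mono A B b)) = ⊤ := by
  set N := Submodule.span F (Set.range (mono A B b)) with hN
  have hmem (i j : ℕ) (hi : i < b) : xCoord A B ^ i * yCoord A B ^ j ∈ N :=
    Submodule.subset_span ⟨(⟨i, hi⟩, j), rfl⟩
  have hy : ∀ r ∈ N, yCoord A B * r ∈ N := by
    intro r hr
    induction hr using Submodule.span_induction with
    | mem r hr =>
      obtain ⟨k, rfl⟩ := hr
      have := hmem k.1 (k.2 + 1) k.1.2
      rw [mono]
      convert this using 1
      ring
    | zero => simp
    | add r s _ _ hr hs => rw [mul_add]; exact N.add_mem hr hs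
    | smul c r _ hr => rw [mul_smul_comm]; exact N.smul_mem c hr
  have hyp (p : F[X]) (r) (hr : r ∈ N) : aeval (yCoord A B) p * r ∈ N := by
    induction p using Polynomial.induction_on' with
    | add p q hp hq => rw [map_add, add_mul]; exact N.add_mem hp hq
    | monomial n c =>
      rw [aeval_monomial, mul_assoc, ← Algebra.smul_def]
      refine N.smul_mem c ?_
      induction n with
      | zero => simpa using hr
      | succ n ih => rw [pow_succ', mul_assoc]; exact hy _ ih
  have hxb : ∀ j, xCoord A B ^ b * yCoord A B ^ j ∈ N := by
    intro j
    have hlc : B.coeff b ≠ 0 := by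
      rw [← hb]; simp only [coeff_natDegree, ne_eq, leadingCoeff_eq_zero]
      rintro rfl; simp at hb; omega
    have h := aeval_yCoord_eq_aeval_xCoord A B
    rw [aeval_eq_sum_range (p := B), hb, Finset.sum_range_succ] at h
    have h2 : B.coeff b • (xCoord A B ^ b * yCoord A B ^ j) ∈ N := by
      have h3 : B.coeff b • (xCoord A B ^ b * yCoord A B ^ j) =
          aeval (yCoord A B) A * (xCoord A B ^ 0 * yCoord A B ^ j) -
          ∑ i ∈ Finset.range b, B.coeff i • (xCoord A B ^ i * yCoord A B ^ j) := by
        rw [h, pow_zero, one_mul, add_mul, Finset.sum_mul, smul_mul_assoc]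
        simp only [smul_mul_assoc, add_sub_cancel_left]
      rw [h3]
      refine N.sub_mem (hyp _ _ (hmem 0 j hb0)) (N.sum_mem fun i hi => N.smul_mem _ ?_)
      exact hmem i j (Finset.mem_range.mp hi)
    exact (N.smul_mem_iff hlc).mp h2
  have hx : ∀ r ∈ N, xCoord A B * r ∈ N := by
    intro r hr
    induction hr using Submodule.span_induction with
    | mem r hr =>
      obtain ⟨k, rfl⟩ := hr
      rw [mono, ← mul_assoc, ← pow_succ']
      rcases Nat.lt_or_ge (k.1 + 1) b with hk | hk
      · exact hmem _ _ hk
      · rw [show (k.1 : ℕ) + 1 = b by omega]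
        exact hxb _
    | zero => simp
    | add r s _ _ hr hs => rw [mul_add]; exact N.add_mem hr hs
    | smul c r _ hr => rw [mul_smul_comm]; exact N.smul_mem c hr
  rw [eq_top_iff]
  intro r _
  refine coordRing_induction A B ?_ hx hy r
  simpa using hmem 0 0 hb0

lemma isIntegral_coordRing {a : ℕ} (ha : A.natDegree = a) (ha0 : 0 < a) :
    Algebra.IsIntegral F[X] (CoordRing A B) := by
  have hlc : A.leadingCoeff ≠ 0 := by
    simp only [ne_eq, leadingCoeff_eq_zero]; rintro rfl; simp at ha; omega
  have hy : IsIntegral F[X] (yCoord A B) := by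
    refine ⟨(A * C A.leadingCoeff⁻¹).map C - C (B * C A.leadingCoeff⁻¹), ?_, ?_⟩
    · have hm := (monic_mul_leadingCoeff_inv (p := A) (by rintro rfl; simp at hlc)).map
        (C : F →+* F[X])
      refine hm.sub_of_left ?_
      rw [degree_map_eq_of_injective C_injective, degree_mul_leadingCoeff_inv _
        (by rintro rfl; simp at hlc)]
      refine degree_C_le.trans_lt ?_
      rw [← natDegree_pos_iff_degree_pos]; omega
    · have h := aeval_yCoord_eq_aeval_xCoord A B
      rw [eval₂_sub, eval₂_C, eval₂_map, sub_eq_zero]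
      have h1 : eval₂ ((algebraMap F[X] (CoordRing A B)).comp C) (yCoord A B)
          (A * C A.leadingCoeff⁻¹) = aeval (yCoord A B) (A * C A.leadingCoeff⁻¹) := rfl
      have h2 : algebraMap F[X] (CoordRing A B) (B * C A.leadingCoeff⁻¹) =
          aeval (xCoord A B) (B * C A.leadingCoeff⁻¹) := by rw [aeval_xCoord]; rfl
      rw [h1, h2, map_mul, map_mul, h, aeval_C, aeval_C]
  constructor
  intro r
  have h1 : r ∈ (integralClosure F[X] (CoordRing A B)).toSubmodule.restrictScalars F := by
    refine coordRing_induction A B ?_ ?_ ?_ r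
    · exact isIntegral_one
    · intro r hr
      exact (isIntegral_algebraMap (R := F[X]) (A := CoordRing A B) (x := X)).mul hr
    · intro r hr
      exact hy.mul hr
  exact h1

end Curve

/-! ### Common poles of `x` and `y` -/

section Curve

variable {F : Type*} [Field F] {A B : F[X]} {a b : ℕ}

lemma algebraMap_smul_coordRing (c : F) (r : CoordRing A B) :
    algebraMap _ (FunctionField A B) (c • r) = c • algebraMap _ (FunctionField A B) r :=
  map_smul (IsScalarTower.toAlgHom F (CoordRing A B) (FunctionField A B)) c r

lemma aeval_yFun_eq_aeval_xFun : aeval (yFun A B) A = aeval (xFun A B) B := by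
  have h := congrArg (algebraMap (CoordRing A B) (FunctionField A B))
    (aeval_yCoord_eq_aeval_xCoord A B)
  rwa [← aeval_algebraMap_apply, ← aeval_algebraMap_apply] at h

/-- The weight of the monomial `x ^ i * y ^ j`. -/
def weight (a b : ℕ) (k : Fin b × ℕ) : ℕ := a * k.1 + b * k.2

/-- Reduction modulo `b` recovers `i < b`, because `a` is invertible there; then `j` follows. -/
lemma weight_injective (hab : Nat.Coprime a b) : Function.Injective (weight a b) := by
  rintro ⟨⟨i, hi⟩, j⟩ ⟨⟨i', hi'⟩, j'⟩ h
  simp only [weight] at h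
  have h1 : i = i' := by
    have h2 : a * i ≡ a * i' [MOD b] := by
      have := congrArg (· % b) h
      simpa [Nat.ModEq, Nat.add_mul_mod_self_left] using this
    exact Nat.ModEq.eq_of_lt_of_lt
      (Nat.ModEq.cancel_left_of_coprime (by rwa [Nat.gcd_comm, ← Nat.coprime_iff_gcd_eq_one]) h2)
      hi hi'
  subst h1
  have h3 : j = j' := by
    have : b * j = b * j' := by omega
    exact Nat.eq_of_mul_eq_mul_left (by omega) this
  subst h3
  rfl

variable [Fact (AbsIrreducible A B)]

/-- `P` is a common pole of `x` and `y`, of orders `a * e` and `b * e`. -/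
def PoleWeights (a b : ℕ) (P : Place F (FunctionField A B)) (e : ℤ) : Prop :=
  0 < e ∧ P.val (xFun A B) = WithZero.exp (a * e) ∧ P.val (yFun A B) = WithZero.exp (b * e)

/-- A pole of one coordinate is a pole of the other. If the orders are `α` and `β`, the leading
terms of `A(y) = B(x)` give `b * α = a * β`, and coprimality yields `b ∣ β`. -/
lemma exists_poleWeights (ha : A.natDegree = a) (hb : B.natDegree = b) (ha0 : 0 < a)
    (hb0 : 0 < b) (hab : Nat.Coprime a b) (P : Place F (FunctionField A B))
    (hP : 1 < P.val (xFun A B) ∨ 1 < P.val (yFun A B)) : ∃ e, PoleWeights a b P e := by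
  have hA : A ≠ 0 := by rintro rfl; simp at ha; omega
  have hB : B ≠ 0 := by rintro rfl; simp at hb; omega
  have h := congrArg P.val (aeval_yFun_eq_aeval_xFun (A := A) (B := B))
  have hx : 1 < P.val (xFun A B) := by
    rcases hP with hP | hP
    · exact hP
    by_contra hx
    have h1 := P.val_aeval_le_one (not_lt.mp hx) B
    rw [← h, P.val_aeval_eq hP hA] at h1
    exact absurd (one_lt_pow₀ hP (by omega)) (not_lt.mpr h1)
  have hy : 1 < P.val (yFun A B) := by
    by_contra hy
    have h1 := P.val_aeval_le_one (not_lt.mp hy) A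
    rw [h, P.val_aeval_eq hx hB] at h1
    exact absurd (one_lt_pow₀ hx (by omega)) (not_lt.mpr h1)
  rw [P.val_aeval_eq hx hB, P.val_aeval_eq hy hA, ha, hb] at h
  obtain ⟨α, hα⟩ : ∃ α : ℤ, P.val (xFun A B) = WithZero.exp α :=
    ⟨_, (WithZero.exp_log (zero_lt_one.trans hx).ne').symm⟩
  obtain ⟨β, hβ⟩ : ∃ β : ℤ, P.val (yFun A B) = WithZero.exp β :=
    ⟨_, (WithZero.exp_log (zero_lt_one.trans hy).ne').symm⟩
  rw [hα, hβ, ← WithZero.exp_nsmul, ← WithZero.exp_nsmul, WithZero.exp_inj, nsmul_eq_mul,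
    nsmul_eq_mul] at h
  have hβ0 : 0 < β := by
    rwa [hβ, ← WithZero.exp_zero, WithZero.exp_lt_exp] at hy
  obtain ⟨e, rfl⟩ : (b : ℤ) ∣ β := by
    exact (Nat.isCoprime_iff_coprime.mpr hab).symm.dvd_of_dvd_mul_left ⟨α, h⟩
  have hbz : (0 : ℤ) < b := by exact_mod_cast hb0
  refine ⟨e, pos_of_mul_pos_right hβ0 hbz.le, ?_, hβ⟩
  rw [hα]
  congr 1
  apply mul_left_cancel₀ hbz.ne'
  rw [← h]; ring

lemma PoleWeights.val_mono {P : Place F (FunctionField A B)} {e : ℤ} (h : PoleWeights a b P e)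
    (k : Fin b × ℕ) :
    P.val (algebraMap _ _ (mono A B b k)) = WithZero.exp (weight a b k * e) := by
  have h1 : algebraMap (CoordRing A B) (FunctionField A B) (mono A B b k) =
      xFun A B ^ (k.1 : ℕ) * yFun A B ^ k.2 := by
    rw [mono, map_mul, map_pow, map_pow]; rfl
  rw [h1, map_mul, map_pow, map_pow, h.2.1, h.2.2, ← WithZero.exp_nsmul, ← WithZero.exp_nsmul,
    ← WithZero.exp_add]
  congr 1
  simp only [weight, nsmul_eq_mul]
  push_cast
  ring

/-- A nonzero element of the coordinate ring has a leading monomial, which is the same at all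
common poles of `x` and `y`. -/
lemma exists_leading_mono (hb : B.natDegree = b) (hb0 : 0 < b) (hab : Nat.Coprime a b)
    {r : CoordRing A B} (hr : r ≠ 0) :
    ∃ (k : Fin b × ℕ) (c : F), c ≠ 0 ∧ ∀ P e, PoleWeights a b P e →
      P.val (algebraMap _ (FunctionField A B) (r - c • mono A B b k)) <
        P.val (algebraMap _ _ (mono A B b k)) := by
  classical
  have h1 : r ∈ Submodule.span F (Set.range (mono A B b)) := by
    rw [span_mono A B hb hb0]; trivial
  obtain ⟨c, rfl⟩ := (Finsupp.mem_span_range_iff_exists_finsupp).mp h1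
  have hc : c.support.Nonempty := by
    rw [Finsupp.support_nonempty_iff]
    rintro rfl
    simp at hr
  obtain ⟨k, hk, hmax⟩ := Finset.exists_max_image c.support (weight a b) hc
  refine ⟨k, c k, by simpa using hk, fun P e he => ?_⟩
  rw [Finsupp.sum, ← Finset.add_sum_erase _ _ hk, add_sub_cancel_left, map_sum]
  apply P.val.map_sum_lt
  · rw [he.val_mono]; simp
  · intro l hl
    have hl' := Finset.mem_erase.mp hl
    rw [algebraMap_smul_coordRing]
    refine (P.val_smul_le _ _).trans_lt ?_
    rw [he.val_mono, he.val_mono, WithZero.exp_lt_exp]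
    have h2 : weight a b l < weight a b k :=
      lt_of_le_of_ne (hmax l hl'.2) fun h => hl'.1 (weight_injective hab h)
    exact mul_lt_mul_of_pos_right (by exact_mod_cast h2) he.1

lemma val_eq_of_leading {P : Place F (FunctionField A B)} {k : Fin b × ℕ} {c : F} (hc : c ≠ 0)
    {r : CoordRing A B}
    (h : P.val (algebraMap _ (FunctionField A B) (r - c • mono A B b k)) <
        P.val (algebraMap _ _ (mono A B b k))) :
    P.val (algebraMap _ (FunctionField A B) r) = P.val (algebraMap _ _ (mono A B b k)) := by
  rw [← P.val_smul_eq hc (algebraMap _ (FunctionField A B) (mono A B b k))] at h ⊢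
  rw [map_sub, algebraMap_smul_coordRing] at h
  exact P.val.map_eq_of_sub_lt h

/-- The pole order of a function at a common pole of `x` and `y` is determined by `e`. -/
lemma exists_poleWeights_val (hb : B.natDegree = b) (hb0 : 0 < b) (hab : Nat.Coprime a b)
    {f : FunctionField A B} (hf : f ≠ 0) :
    ∃ N : ℤ, ∀ P e, PoleWeights a b P e → P.val f = WithZero.exp (N * e) := by
  obtain ⟨r, s, hs, rfl⟩ := IsFractionRing.div_surjective (CoordRing A B) f
  have hs0 : s ≠ 0 := nonZeroDivisors.ne_zero hs
  have hr0 : r ≠ 0 := by rintro rfl; simp at hf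
  obtain ⟨k, c, hc, hk⟩ := exists_leading_mono hb hb0 hab hr0
  obtain ⟨l, d, hd, hl⟩ := exists_leading_mono hb hb0 hab hs0
  refine ⟨weight a b k - weight a b l, fun P e he => ?_⟩
  rw [map_div₀, val_eq_of_leading hc (hk P e he), val_eq_of_leading hd (hl P e he),
    he.val_mono, he.val_mono, ← WithZero.exp_sub, sub_mul]

/-- All values at `P` are powers of `exp e`, whereas the normalised valuation attains `exp 1`. -/
lemma PoleWeights.eq_one (hb : B.natDegree = b) (hb0 : 0 < b) (hab : Nat.Coprime a b)
    {P : Place F (FunctionField A B)} {e : ℤ} (he : PoleWeights a b P e) : e = 1 := by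
  obtain ⟨f, hf⟩ := P.exists_val_eq_exp_one
  have hf0 : f ≠ 0 := by
    rintro rfl
    rw [map_zero] at hf
    exact WithZero.exp_ne_zero hf.symm
  obtain ⟨N, hN⟩ := exists_poleWeights_val hb hb0 hab hf0
  rw [hN P e he, WithZero.exp_inj] at hf
  rcases Int.eq_one_or_neg_one_of_mul_eq_one' hf with h | h
  · exact h.2
  · have := he.1; omega

/-- The leading monomials of numerator and denominator do not depend on the pole, so both places
have the same valuation ring. -/
lemma PoleWeights.eq (hb : B.natDegree = b) (hb0 : 0 < b) (hab : Nat.Coprime a b)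
    {P P' : Place F (FunctionField A B)} {e e' : ℤ} (he : PoleWeights a b P e)
    (he' : PoleWeights a b P' e') : P = P' := by
  obtain rfl := he.eq_one hb hb0 hab
  obtain rfl := he'.eq_one hb hb0 hab
  apply Place.eq_of_val_le_one_imp
  intro f
  by_cases hf : f = 0
  · simp [hf]
  obtain ⟨N, hN⟩ := exists_poleWeights_val hb hb0 hab hf
  rw [hN P 1 he, hN P' 1 he']

/-- Functions of equal pole order at the common pole agree up to a constant factor and terms of
smaller pole order. -/
lemma PoleWeights.exists_val_sub_smul_lt (hb : B.natDegree = b) (hb0 : 0 < b)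
    (hab : Nat.Coprime a b) {P : Place F (FunctionField A B)} {e : ℤ} (he : PoleWeights a b P e)
    {f g : FunctionField A B} (hg : g ≠ 0) (hfg : P.val f = P.val g) :
    ∃ c : F, P.val (f - c • g) < P.val g := by
  have hvg : P.val g ≠ 0 := by simpa using hg
  have hf : f ≠ 0 := by rintro rfl; simp at hfg; exact hg (by simpa using hfg.symm)
  obtain ⟨r, s, hs, hrs⟩ := IsFractionRing.div_surjective (CoordRing A B) (f / g)
  have hs0 : s ≠ 0 := nonZeroDivisors.ne_zero hs
  have hsK : algebraMap _ (FunctionField A B) s ≠ 0 := by simpa using hs0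
  have hr0 : r ≠ 0 := by
    rintro rfl
    simp only [map_zero, zero_div] at hrs
    exact div_ne_zero hf hg hrs.symm
  obtain ⟨k, c, hc, hk⟩ := exists_leading_mono hb hb0 hab hr0
  obtain ⟨l, d, hd, hl⟩ := exists_leading_mono hb hb0 hab hs0
  replace hk := hk P e he
  replace hl := hl P e he
  have hval : P.val (algebraMap _ (FunctionField A B) r) =
      P.val (algebraMap _ (FunctionField A B) s) := by
    have h := congrArg P.val hrs
    rw [map_div₀, map_div₀, hfg, div_self hvg, div_eq_one_iff_eq (by simpa using hs0)] at h
    exact h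
  have hkl : k = l := by
    rw [val_eq_of_leading hc hk, val_eq_of_leading hd hl, he.val_mono, he.val_mono,
      WithZero.exp_inj] at hval
    exact weight_injective hab (by exact_mod_cast mul_right_cancel₀ he.1.ne' hval)
  subst hkl
  -- `r` and `s` share the leading monomial, with coefficients `c` and `d`, so it cancels in `r - (c
  -- / d) • s`.
  refine ⟨c / d, ?_⟩
  have h1 : f - (c / d) • g =
      g / algebraMap _ _ s * algebraMap _ _ (r - (c / d) • s) := by
    rw [map_sub, algebraMap_smul_coordRing]
    have h2 : f = g * (algebraMap _ _ r / algebraMap _ _ s) := by rw [hrs]; field_simp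
    rw [h2, Algebra.smul_def, Algebra.smul_def]
    field_simp
  have h3 : r - (c / d) • s = (r - c • mono A B b k) - (c / d) • (s - d • mono A B b k) := by
    rw [smul_sub, smul_smul, div_mul_cancel₀ _ hd]; abel
  have h4 : P.val (algebraMap _ (FunctionField A B) (r - (c / d) • s)) <
      P.val (algebraMap _ _ s) := by
    rw [h3, map_sub, val_eq_of_leading hd hl, algebraMap_smul_coordRing]
    exact P.val.map_sub_lt hk ((P.val_smul_le _ _).trans_lt hl)
  have hvs : 0 < P.val (algebraMap _ (FunctionField A B) s) :=
    zero_lt_iff.mpr (by simpa using hs0)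
  rw [h1, map_mul, map_div₀, div_mul_eq_mul_div, div_lt_iff₀ hvs]
  exact mul_lt_mul_of_pos_left h4 (zero_lt_iff.mpr hvg)

end Curve

/-! ### Places as primes of a Dedekind domain -/

section Centre

open IsDedekindDomain

variable {F K R : Type*} [Field F] [Field K] [Algebra F K] [CommRing R] [IsDedekindDomain R]
  [Algebra R K] [IsFractionRing R K]

/-- The centre in `R` of a place whose valuation ring contains `R`. -/
def Place.centre (P : Place F K) (hP : ∀ r : R, P.val (algebraMap R K r) ≤ 1) :
    HeightOneSpectrum R where
  asIdeal :=
    { carrier := {r | P.val (algebraMap R K r) < 1}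
      zero_mem' := by simp
      add_mem' := fun {r s} hr hs => by
        simp only [Set.mem_ofPred_eq, map_add] at *
        exact P.val.map_add_lt hr hs
      smul_mem' := fun c r hr => by
        simp only [Set.mem_ofPred_eq, smul_eq_mul, map_mul] at *
        exact (mul_le_of_le_one_left' (hP c)).trans_lt hr }
  isPrime := by
    rw [Ideal.isPrime_iff]
    constructor
    · rw [Ideal.ne_top_iff_one]
      change ¬ P.val (algebraMap R K 1) < 1
      simp
    · intro r s hrs
      change P.val (algebraMap R K (r * s)) < 1 at hrs
      change P.val (algebraMap R K r) < 1 ∨ P.val (algebraMap R K s) < 1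
      by_contra! h
      rw [map_mul, map_mul, le_antisymm (hP r) h.1, le_antisymm (hP s) h.2, mul_one] at hrs
      exact lt_irrefl _ hrs
  ne_bot := by
    intro h
    obtain ⟨f, hf⟩ := P.exists_val_eq_exp_one
    -- A zero centre would make the valuation trivial on `R`, hence on `K`.
    have h1 (r : R) (hr : r ≠ 0) : P.val (algebraMap R K r) = 1 := by
      refine le_antisymm (hP r) (not_lt.mp fun hlt => hr ?_)
      rw [← Ideal.mem_bot, ← h]
      exact hlt
    have hf0 : f ≠ 0 := by
      rintro rfl
      rw [map_zero] at hf
      exact WithZero.exp_ne_zero hf.symm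
    obtain ⟨r, s, hs, rfl⟩ := IsFractionRing.div_surjective R f
    have hs0 : s ≠ 0 := nonZeroDivisors.ne_zero hs
    have hr0 : r ≠ 0 := by rintro rfl; simp at hf0
    rw [map_div₀, h1 r hr0, h1 s hs0, div_one, ← WithZero.exp_zero, WithZero.exp_inj] at hf
    omega

lemma Place.mem_centre (P : Place F K) (hP : ∀ r : R, P.val (algebraMap R K r) ≤ 1) (r : R) :
    r ∈ (P.centre hP).asIdeal ↔ P.val (algebraMap R K r) < 1 := Iff.rfl

variable [Algebra F R] [IsScalarTower F R K]

/-- The place attached to a nonzero prime of a Dedekind domain. -/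
def placeOfPrime (F K : Type*) [Field F] [Field K] [Algebra F K] [Algebra F R] [Algebra R K]
    [IsScalarTower F R K] [IsFractionRing R K] (v : HeightOneSpectrum R) : Place F K where
  toValuationSubring := (v.valuation K).valuationSubring
  algebraMap_mem c := by
    rw [IsScalarTower.algebraMap_apply F R K]
    exact v.valuation_le_one _
  isDVR := (v.valuation K).valuationSubring_isDiscreteValuationRing

lemma placeOfPrime_val_le_one_iff (v : HeightOneSpectrum R) (f : K) :
    (placeOfPrime F K v).val f ≤ 1 ↔ v.valuation K f ≤ 1 :=
  (Place.val_le_one_iff _ _).trans (Valuation.mem_valuationSubring_iff _ _)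

/-- An element integral at the centre is a fraction with denominator outside the centre, hence a
unit at `P`. This gives one inclusion of valuation rings; the other follows by passing to `f⁻¹`. -/
lemma Place.eq_placeOfPrime_centre (P : Place F K)
    (hP : ∀ r : R, P.val (algebraMap R K r) ≤ 1) : P = placeOfPrime F K (P.centre hP) := by
  have key (f : K) (hf : (P.centre hP).valuation K f ≤ 1) :
      ∃ n : R, P.val f = P.val (algebraMap R K n) ∧
        (P.centre hP).valuation K f = (P.centre hP).valuation K (algebraMap R K n) := by
    obtain ⟨n, d, hnd⟩ := (P.centre hP).exists_primeCompl_mul_eq_of_integer f hf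
    have hd : P.val (algebraMap R K d) = 1 :=
      le_antisymm (hP d) (not_lt.mp d.2)
    refine ⟨n, ?_, ?_⟩
    · rw [← hnd, map_mul, hd, mul_one]
    · rw [← hnd, map_mul, ((P.centre hP).valuation_eq_one_iff_notMem (K := K)).mpr d.2, mul_one]
  apply Place.eq_of_val_le_one_imp
  intro f
  rw [placeOfPrime_val_le_one_iff]
  constructor
  · intro h
    by_contra hf
    have hinv : (P.centre hP).valuation K f⁻¹ < 1 := by
      rw [map_inv₀]; exact inv_lt_one_of_one_lt₀ (not_le.mp hf)
    obtain ⟨n, hn, hn'⟩ := key f⁻¹ hinv.le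
    rw [hn', HeightOneSpectrum.valuation_lt_one_iff_mem, Place.mem_centre, ← hn, map_inv₀] at hinv
    have hf0 : P.val f ≠ 0 := by
      intro h0
      rw [map_eq_zero] at h0
      simp [h0] at hf
    exact absurd h (not_le.mpr ((inv_lt_one₀ (zero_lt_iff.mpr hf0)).mp hinv))
  · intro h
    obtain ⟨n, hn, -⟩ := key f h
    rw [hn]
    exact hP n

lemma Place.eq_of_centre_eq {P P' : Place F K} (hP : ∀ r : R, P.val (algebraMap R K r) ≤ 1)
    (hP' : ∀ r : R, P'.val (algebraMap R K r) ≤ 1) (h : P.centre hP = P'.centre hP') :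
    P = P' := by
  rw [P.eq_placeOfPrime_centre hP, P'.eq_placeOfPrime_centre hP', h]

end Centre

/-! ### Normality of the coordinate ring -/

section Curve

open IsDedekindDomain

variable {F : Type*} [Field F] {A B : F[X]} {a b : ℕ} [Fact (AbsIrreducible A B)]
  {Q : Place F (FunctionField A B)}

lemma PoleWeights.val_le_one (ha : A.natDegree = a) (hb : B.natDegree = b) (ha0 : 0 < a)
    (hb0 : 0 < b) (hab : Nat.Coprime a b) {e : ℤ} (hQ : PoleWeights a b Q e)
    {P : Place F (FunctionField A B)} (hP : P ≠ Q) (r : CoordRing A B) :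
    P.val (algebraMap _ (FunctionField A B) r) ≤ 1 := by
  have hxy : P.val (xFun A B) ≤ 1 ∧ P.val (yFun A B) ≤ 1 := by
    by_contra h
    obtain ⟨e', he'⟩ := exists_poleWeights ha hb ha0 hb0 hab P (by
      rwa [not_and_or, not_le, not_le] at h)
    exact hP (he'.eq hb hb0 hab hQ)
  have h1 : r ∈ Submodule.span F (Set.range (mono A B b)) := by
    rw [span_mono A B hb hb0]; trivial
  induction h1 using Submodule.span_induction with
  | mem r hr =>
    obtain ⟨k, rfl⟩ := hr
    have h2 : algebraMap (CoordRing A B) (FunctionField A B) (mono A B b k) =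
        xFun A B ^ (k.1 : ℕ) * yFun A B ^ k.2 := by
      rw [mono, map_mul, map_pow, map_pow]; rfl
    rw [h2, map_mul, map_pow, map_pow]
    exact mul_le_one' (pow_le_one' hxy.1 _) (pow_le_one' hxy.2 _)
  | zero => simp
  | add r s _ _ hr hs => rw [map_add]; exact (P.val.map_add _ _).trans (max_le hr hs)
  | smul c r _ hr => rw [algebraMap_smul_coordRing]; exact (P.val_smul_le _ _).trans hr

lemma PoleWeights.one_le_val (hb : B.natDegree = b) (hb0 : 0 < b) (hab : Nat.Coprime a b)
    {e : ℤ} (hQ : PoleWeights a b Q e) {r : CoordRing A B} (hr : r ≠ 0) :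
    1 ≤ Q.val (algebraMap _ (FunctionField A B) r) := by
  obtain ⟨k, c, hc, hk⟩ := exists_leading_mono hb hb0 hab hr
  rw [val_eq_of_leading hc (hk Q e hQ), hQ.val_mono, ← WithZero.exp_zero, WithZero.exp_le_exp]
  exact mul_nonneg (by positivity) hQ.1.le

/-- Some `r ≠ 0` has `r * g ^ n ∈ R` for all `n`. A zero of `g` at `Q` would make these products
vanish at `Q` for large `n`, while nonzero elements of `R` never do. -/
lemma PoleWeights.eq_zero_of_isIntegral (hb : B.natDegree = b) (hb0 : 0 < b)
    (hab : Nat.Coprime a b) {e : ℤ} (hQ : PoleWeights a b Q e) {g : FunctionField A B}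
    (hg : IsIntegral (CoordRing A B) g) (hg1 : Q.val g < 1) : g = 0 := by
  by_contra hg0
  obtain ⟨r, hr, h⟩ := hg.isAlmostIntegral
  have hr0 : r ≠ 0 := nonZeroDivisors.ne_zero hr
  obtain ⟨ρ, hρ⟩ : ∃ ρ : ℤ, Q.val (algebraMap _ (FunctionField A B) r) = WithZero.exp ρ :=
    ⟨_, (WithZero.exp_log (by simpa using hr0)).symm⟩
  obtain ⟨γ, hγ⟩ : ∃ γ : ℤ, Q.val g = WithZero.exp γ :=
    ⟨_, (WithZero.exp_log (by simpa using hg0)).symm⟩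
  have hγ0 : γ < 0 := by
    rwa [hγ, ← WithZero.exp_zero, WithZero.exp_lt_exp] at hg1
  obtain ⟨s, hs⟩ := h (ρ.toNat + 1)
  have hsne : r • g ^ (ρ.toNat + 1) ≠ 0 := by
    rw [Algebra.smul_def]
    exact mul_ne_zero (by simpa using hr0) (pow_ne_zero _ hg0)
  have hs0 : s ≠ 0 := by rintro rfl; rw [map_zero] at hs; exact hsne hs.symm
  have h1 := hQ.one_le_val hb hb0 hab hs0
  have hs' : algebraMap _ (FunctionField A B) s = r • g ^ (ρ.toNat + 1) := hs
  rw [hs', Algebra.smul_def, map_mul, map_pow, hρ, hγ, ← WithZero.exp_nsmul, ← WithZero.exp_add,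
    ← WithZero.exp_zero, WithZero.exp_le_exp, nsmul_eq_mul] at h1
  push_cast at h1
  have h2 := Int.self_le_toNat ρ
  nlinarith [Int.natCast_nonneg ρ.toNat]

/-- If `H(Q)` is generated by `a` and `b`, then the affine coordinate ring is normal. -/
lemma exists_eq_of_isIntegral (ha : A.natDegree = a) (hb : B.natDegree = b) (ha0 : 0 < a)
    (hb0 : 0 < b) (hab : Nat.Coprime a b) (hQ : PoleWeights a b Q 1)
    (hH : weierstrassSemigroup Q = (AddSubmonoid.closure {a, b} : AddSubmonoid ℕ))
    {g : FunctionField A B} (hg : IsIntegral (CoordRing A B) g) :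
    ∃ r, algebraMap (CoordRing A B) (FunctionField A B) r = g := by
  -- Descent on a strict bound for the pole order at `Q`; for `N = 0` the function vanishes at `Q`,
  -- hence is zero.
  have main : ∀ N : ℕ, ∀ g : FunctionField A B, IsIntegral (CoordRing A B) g →
      Q.val g < WithZero.exp (N : ℤ) →
      ∃ r, algebraMap (CoordRing A B) (FunctionField A B) r = g := by
    intro N
    induction N with
    | zero =>
      intro g hg hgN
      exact ⟨0, by rw [map_zero, hQ.eq_zero_of_isIntegral hb hb0 hab hg (by simpa using hgN)]⟩
    | succ N ih =>
      intro g hg hgN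
      by_cases hg0 : g = 0
      · exact ⟨0, by rw [map_zero, hg0]⟩
      obtain ⟨γ, hγ⟩ : ∃ γ : ℤ, Q.val g = WithZero.exp γ :=
        ⟨_, (WithZero.exp_log (by simpa using hg0)).symm⟩
      rcases lt_or_ge γ N with hlt | hge
      · exact ih g hg (by rwa [hγ, WithZero.exp_lt_exp])
      have hγN : γ = N := by
        rw [hγ, WithZero.exp_lt_exp] at hgN
        push_cast at hgN
        omega
      subst hγN
      have hN : N ∈ weierstrassSemigroup Q := by
        refine ⟨g, hg0, fun P hP => not_lt.mpr ?_, ?_⟩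
        · exact P.val_le_one_of_isIntegral (hQ.val_le_one ha hb ha0 hb0 hab hP) hg
        · rw [Place.poleOrder, hγ, WithZero.log_exp]
      rw [hH, SetLike.mem_coe, AddSubmonoid.mem_closure_pair] at hN
      obtain ⟨i, j, hij⟩ := hN
      set s : CoordRing A B := xCoord A B ^ i * yCoord A B ^ j with hs
      have hsv : Q.val (algebraMap _ (FunctionField A B) s) = WithZero.exp (N : ℤ) := by
        have h2 : algebraMap (CoordRing A B) (FunctionField A B) s =
            xFun A B ^ i * yFun A B ^ j := by
          rw [hs, map_mul, map_pow, map_pow]; rfl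
        rw [h2, map_mul, map_pow, map_pow, hQ.2.1, hQ.2.2, ← WithZero.exp_nsmul,
          ← WithZero.exp_nsmul, ← WithZero.exp_add, ← hij]
        congr 1
        simp
      have hs0 : algebraMap _ (FunctionField A B) s ≠ 0 := by
        intro h0
        rw [h0, map_zero] at hsv
        exact WithZero.exp_ne_zero hsv.symm
      obtain ⟨c, hc⟩ := hQ.exists_val_sub_smul_lt hb hb0 hab hs0 (hγ.trans hsv.symm)
      rw [hsv] at hc
      obtain ⟨r, hr⟩ := ih _ (hg.sub (by
        rw [← algebraMap_smul_coordRing]; exact isIntegral_algebraMap)) hc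
      exact ⟨r + c • s, by rw [map_add, algebraMap_smul_coordRing, hr, sub_add_cancel]⟩
  obtain ⟨N, hN⟩ : ∃ N : ℕ, Q.val g < WithZero.exp (N : ℤ) := by
    by_cases hg0 : g = 0
    · exact ⟨0, by simp [hg0]⟩
    · refine ⟨(Q.poleOrder g).toNat + 1, ?_⟩
      rw [← WithZero.exp_log (show Q.val g ≠ 0 by simpa using hg0), WithZero.exp_lt_exp]
      have := Int.self_le_toNat (Q.poleOrder g)
      push_cast
      exact Int.lt_add_one_of_le this
  exact main N g hg hN

lemma isDedekindDomain_coordRing (ha : A.natDegree = a) (hb : B.natDegree = b) (ha0 : 0 < a)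
    (hb0 : 0 < b) (hab : Nat.Coprime a b) (hQ : PoleWeights a b Q 1)
    (hH : weierstrassSemigroup Q = (AddSubmonoid.closure {a, b} : AddSubmonoid ℕ)) :
    IsDedekindDomain (CoordRing A B) := by
  have := isIntegral_coordRing A B ha ha0
  have h1 : IsDedekindRing (CoordRing A B) := by
    rw [isDedekindRing_iff (CoordRing A B) (FunctionField A B)]
    exact ⟨inferInstance, Ring.DimensionLEOne.of_isIntegral F[X] _,
      fun hg => exists_eq_of_isIntegral ha hb ha0 hb0 hab hQ hH hg⟩
  exact {}

/-- The functions without poles outside `Q` are the elements of the coordinate ring. -/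
lemma exists_eq_of_regular [IsDedekindDomain (CoordRing A B)] {e : ℤ}
    (hQ : PoleWeights a b Q e) (hb0 : 0 < b) {f : FunctionField A B}
    (hf : ∀ P ≠ Q, P.val f ≤ 1) :
    ∃ r, algebraMap (CoordRing A B) (FunctionField A B) r = f := by
  refine HeightOneSpectrum.mem_integers_of_valuation_le_one _ f fun v => ?_
  rw [← placeOfPrime_val_le_one_iff (F := F)]
  -- A place coming from a prime of `R` is not `Q`, since `y ∈ R` is regular there.
  refine hf _ ?_
  rintro rfl
  have h1 := (placeOfPrime_val_le_one_iff (F := F) v (yFun A B)).mpr (v.valuation_le_one _)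
  rw [hQ.2.2, ← WithZero.exp_zero, WithZero.exp_le_exp] at h1
  have : (0 : ℤ) < b := by exact_mod_cast hb0
  have := mul_pos this hQ.1
  omega

end Curve

/-! ### Spans of subfamilies of an independent family -/

section LinearIndependence

lemma span_image_inf_span_image {F M ι : Type*} [Field F] [AddCommGroup M] [Module F M]
    {v : ι → M} (hv : LinearIndependent F v) (s t : Set ι) :
    Submodule.span F (v '' s) ⊓ Submodule.span F (v '' t) = Submodule.span F (v '' (s ∩ t)) := by
  refine le_antisymm ?_ (le_inf (Submodule.span_mono (Set.image_mono Set.inter_subset_left))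
    (Submodule.span_mono (Set.image_mono Set.inter_subset_right)))
  rintro f ⟨hs, ht⟩
  rw [SetLike.mem_coe, Finsupp.mem_span_image_iff_linearCombination] at hs ht
  obtain ⟨l, hl, rfl⟩ := hs
  obtain ⟨l', hl', h⟩ := ht
  rw [hv.finsuppLinearCombination_injective.eq_iff] at h
  subst h
  rw [Finsupp.mem_span_image_iff_linearCombination]
  exact ⟨l', by rw [Finsupp.supported_inter]; exact ⟨hl, hl'⟩, rfl⟩

lemma finrank_span_image {F M ι : Type*} [Field F] [AddCommGroup M] [Module F M]
    {v : ι → M} (hv : LinearIndependent F v) {s : Set ι} (hs : s.Finite) :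
    Module.finrank F (Submodule.span F (v '' s)) = s.ncard := by
  have := hs.fintype
  rw [Set.image_eq_range]
  exact (finrank_span_eq_card (hv.comp _ Subtype.val_injective)).trans
    (by rw [Set.ncard_eq_toFinset_card', Set.toFinset_card])

end LinearIndependence

/-! ### Monomial bases and counting weights -/

section Curve

variable {F : Type*} [Field F] {A B : F[X]} {a b : ℕ}

variable (A B) in
/-- The monomial `x ^ i * y ^ j` in the function field, where `i < b`. -/
def monoFun (b : ℕ) (k : Fin b × ℕ) : FunctionField A B := algebraMap _ _ (mono A B b k)

lemma monoFun_eq (k : Fin b × ℕ) :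
    monoFun A B b k = xFun A B ^ (k.1 : ℕ) * yFun A B ^ k.2 := by
  rw [monoFun, mono, map_mul, map_pow, map_pow]; rfl

lemma polySpace_eq_span (hb : B.natDegree = b) :
    polySpace A B = Submodule.span F (monoFun A B b '' {k | (k.1 : ℕ) < b - 1}) := by
  rw [polySpace, hb]
  apply le_antisymm
  · refine iSup₂_le fun i hi => ?_
    rw [Algebra.adjoin_eq_span, Submodule.map_span, Submodule.span_le]
    rintro _ ⟨g, hg, rfl⟩
    obtain ⟨j, rfl⟩ := Submonoid.mem_closure_singleton.mp hg
    have hi' := Finset.mem_range.mp hi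
    refine Submodule.subset_span ⟨(⟨i, by omega⟩, j), hi', ?_⟩
    rw [monoFun_eq, LinearMap.mulRight_apply, mul_comm]
  · rw [Submodule.span_le]
    rintro _ ⟨k, hk, rfl⟩
    refine Submodule.mem_iSup_of_mem (k.1 : ℕ)
      (Submodule.mem_iSup_of_mem (Finset.mem_range.mpr hk) ?_)
    refine ⟨yFun A B ^ k.2, pow_mem (Algebra.self_mem_adjoin_singleton F _) _, ?_⟩
    rw [monoFun_eq, LinearMap.mulRight_apply, mul_comm]

lemma finite_weight_le (hab : Nat.Coprime a b) (m : ℕ) :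
    {k : Fin b × ℕ | weight a b k ≤ m}.Finite :=
  (Set.finite_Iic m).preimage (weight_injective hab).injOn

/-- Weights are distinct, so at most `m` of them lie in `(N, N + m]`. -/
lemma ncard_weight_le_add_le (hab : Nat.Coprime a b) (N m : ℕ) :
    {k : Fin b × ℕ | weight a b k ≤ N + m}.ncard ≤ {k : Fin b × ℕ | weight a b k ≤ N}.ncard + m := by
  have h1 : {k : Fin b × ℕ | weight a b k ≤ N + m} ⊆
      {k : Fin b × ℕ | weight a b k ≤ N} ∪ {k | weight a b k ∈ Set.Ioc N (N + m)} := by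
    intro k hk
    rcases le_or_gt (weight a b k) N with h | h
    · exact Or.inl h
    · exact Or.inr ⟨h, hk⟩
  have hfin' : {k : Fin b × ℕ | weight a b k ∈ Set.Ioc N (N + m)}.Finite :=
    (Set.finite_Ioc _ _).preimage (weight_injective hab).injOn
  refine (Set.ncard_le_ncard h1 ((finite_weight_le hab N).union hfin')).trans ((Set.ncard_union_le _ _).trans ?_)
  gcongr
  have h2 := Set.ncard_le_ncard_of_injOn (s := {k : Fin b × ℕ | weight a b k ∈ Set.Ioc N (N + m)})
    (t := Set.Ioc N (N + m)) (weight a b) (fun k hk => hk) (weight_injective hab).injOn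
  simpa [Set.ncard_eq_toFinset_card'] using h2

/-- The monomials lost are `x ^ (b - 1) * y ^ j` with `b * j ≤ m - a * (b - 1)`; the `+ 1` counts `j
= 0`. -/
lemma ncard_weight_le_eq (hab : Nat.Coprime a b) (hb0 : 0 < b) {m : ℕ} (hm : a * (b - 1) ≤ m) :
    {k : Fin b × ℕ | weight a b k ≤ m}.ncard =
      {k : Fin b × ℕ | weight a b k ≤ m ∧ (k.1 : ℕ) < b - 1}.ncard + ((m - a * (b - 1)) / b + 1) := by
  set top : ℕ → Fin b × ℕ := fun j => (⟨b - 1, by omega⟩, j) with htop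
  have hinj : Function.Injective top := fun j j' h => congrArg Prod.snd h
  have h1 : {k : Fin b × ℕ | weight a b k ≤ m} =
      {k : Fin b × ℕ | weight a b k ≤ m ∧ (k.1 : ℕ) < b - 1} ∪
        top '' Set.Iio ((m - a * (b - 1)) / b + 1) := by
    ext ⟨⟨i, hi⟩, j⟩
    have key (j : ℕ) : a * (b - 1) + b * j ≤ m ↔ j < (m - a * (b - 1)) / b + 1 := by
      rw [Nat.lt_succ_iff, Nat.le_div_iff_mul_le hb0, mul_comm j b]
      omega
    simp only [weight, htop, Set.mem_ofPred_eq, Set.mem_union, Set.mem_image, Set.mem_Iio,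
      Prod.mk.injEq, Fin.mk.injEq]
    constructor
    · intro h
      rcases Nat.lt_or_ge i (b - 1) with hlt | hge
      · exact Or.inl ⟨h, hlt⟩
      · have : i = b - 1 := by omega
        subst this
        exact Or.inr ⟨j, (key j).mp h, rfl, rfl⟩
    · rintro (h | ⟨j', h, rfl, rfl⟩)
      · exact h.1
      · exact (key j').mpr h
  rw [h1, Set.ncard_union_eq ?_ ((finite_weight_le hab m).subset fun k hk => hk.1) ((Set.finite_Iio _).image _),
    Set.ncard_image_of_injective _ hinj]
  · simp [Set.ncard_eq_toFinset_card']
  · rw [Set.disjoint_left]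
    rintro k ⟨-, hk⟩ ⟨j, -, rfl⟩
    exact lt_irrefl _ hk

variable [Fact (AbsIrreducible A B)] {Q : Place F (FunctionField A B)}

lemma PoleWeights.exists_val_linearCombination (hab : Nat.Coprime a b)
    {e : ℤ} (hQ : PoleWeights a b Q e) {c : Fin b × ℕ →₀ F} (hc : c ≠ 0) :
    ∃ k ∈ c.support, (∀ l ∈ c.support, weight a b l ≤ weight a b k) ∧
      Q.val (Finsupp.linearCombination F (monoFun A B b) c) =
        WithZero.exp (weight a b k * e) := by
  classical
  obtain ⟨k, hk, hmax⟩ := Finset.exists_max_image c.support (weight a b)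
    (Finsupp.support_nonempty_iff.mpr hc)
  refine ⟨k, hk, hmax, ?_⟩
  have hv (l) (hl : l ∈ c.support) :
      Q.val (c l • monoFun A B b l) = WithZero.exp (weight a b l * e) := by
    rw [Q.val_smul_eq (by simpa using hl)]
    exact hQ.val_mono l
  rw [Finsupp.linearCombination_apply, Finsupp.sum, Q.val.map_sum_eq_of_lt hk, hv k hk]
  intro l hl
  rw [Finset.mem_sdiff, Finset.mem_singleton] at hl
  rw [hv k hk, hv l hl.1, WithZero.exp_lt_exp]
  have h2 : weight a b l < weight a b k :=
    lt_of_le_of_ne (hmax l hl.1) fun h => hl.2 (weight_injective hab h)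
  exact mul_lt_mul_of_pos_right (by exact_mod_cast h2) hQ.1

lemma PoleWeights.linearIndependent_monoFun (hab : Nat.Coprime a b) {e : ℤ}
    (hQ : PoleWeights a b Q e) : LinearIndependent F (monoFun A B b) := by
  rw [linearIndependent_iff]
  intro c h
  by_contra hc
  obtain ⟨k, -, -, hk⟩ := hQ.exists_val_linearCombination hab hc
  rw [h, map_zero] at hk
  exact WithZero.exp_ne_zero hk.symm

lemma mem_riemannSpace_single (m : ℕ) (f : FunctionField A B) :
    f ∈ riemannSpace (Finsupp.single Q (m : ℤ)) ↔
      Q.val f ≤ WithZero.exp (m : ℤ) ∧ ∀ P ≠ Q, P.val f ≤ 1 := by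
  constructor
  · intro h
    refine ⟨by simpa using h Q, fun P hP => ?_⟩
    simpa [Finsupp.single_eq_of_ne hP] using h P
  · rintro ⟨h1, h2⟩ P
    by_cases hP : P = Q
    · subst hP; simpa using h1
    · simpa [Finsupp.single_eq_of_ne hP] using h2 P hP

lemma riemannSpace_eq_span (ha : A.natDegree = a) (hb : B.natDegree = b) (ha0 : 0 < a)
    (hb0 : 0 < b) (hab : Nat.Coprime a b) [IsDedekindDomain (CoordRing A B)]
    (hQ : PoleWeights a b Q 1) (m : ℕ) :
    riemannSpace (Finsupp.single Q (m : ℤ)) =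
      Submodule.span F (monoFun A B b '' {k | weight a b k ≤ m}) := by
  apply le_antisymm
  · intro f hf
    rw [mem_riemannSpace_single] at hf
    obtain ⟨r, rfl⟩ := exists_eq_of_regular hQ hb0 hf.2
    have h1 : r ∈ Submodule.span F (Set.range (mono A B b)) := by
      rw [span_mono A B hb hb0]; trivial
    obtain ⟨c, rfl⟩ := (Finsupp.mem_span_range_iff_exists_finsupp).mp h1
    have h2 : algebraMap _ (FunctionField A B) (c.sum fun i a => a • mono A B b i) =
        Finsupp.linearCombination F (monoFun A B b) c := by
      rw [Finsupp.linearCombination_apply, Finsupp.sum, Finsupp.sum, map_sum]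
      exact Finset.sum_congr rfl fun k _ => algebraMap_smul_coordRing _ _
    rw [h2] at hf ⊢
    rw [Finsupp.mem_span_image_iff_linearCombination]
    refine ⟨c, ?_, rfl⟩
    by_cases hc : c = 0
    · rw [hc]; exact Submodule.zero_mem _
    obtain ⟨k, hk, hmax, hval⟩ := hQ.exists_val_linearCombination (A := A) (B := B) hab hc
    rw [hval, WithZero.exp_le_exp, mul_one] at hf
    intro l hl
    exact (hmax l hl).trans (by exact_mod_cast hf.1)
  · rw [Submodule.span_le]
    rintro _ ⟨k, hk, rfl⟩
    rw [SetLike.mem_coe, mem_riemannSpace_single]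
    refine ⟨?_, fun P hP => hQ.val_le_one ha hb ha0 hb0 hab hP _⟩
    rw [monoFun, hQ.val_mono, WithZero.exp_le_exp, mul_one]
    exact_mod_cast hk

end Curve

/-! ### Generalized Hamming weights of subcodes -/

section WeightLemmas

variable {F ι : Type*} [Field F]

lemma exists_submodule_le_finrank_eq {M : Type*} [AddCommGroup M] [Module F M]
    (C : Submodule F M) {t : ℕ} (ht : t ≤ Module.finrank F C) :
    ∃ E ≤ C, Module.finrank F E = t := by
  obtain ⟨v, hv⟩ := exists_linearIndependent_of_le_finrank ht
  refine ⟨(Submodule.span F (Set.range v)).map C.subtype, Submodule.map_subtype_le _ _, ?_⟩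
  rw [Submodule.finrank_map_subtype_eq, finrank_span_eq_card hv, Fintype.card_fin]

lemma exists_genHammingWeight_eq (C : Submodule F (ι → F)) {t : ℕ}
    (ht : t ≤ Module.finrank F C) :
    ∃ E ≤ C, Module.finrank F E = t ∧ (codeSupport E).ncard = genHammingWeight C t := by
  obtain ⟨E, hE, hEt⟩ := exists_submodule_le_finrank_eq C ht
  exact Nat.sInf_mem (s := {s | ∃ E : Submodule F (ι → F), E ≤ C ∧ Module.finrank F E = t ∧
    (codeSupport E).ncard = s}) ⟨_, E, hE, hEt, rfl⟩

lemma genHammingWeight_le {C E : Submodule F (ι → F)} (hE : E ≤ C) :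
    genHammingWeight C (Module.finrank F E) ≤ (codeSupport E).ncard :=
  Nat.sInf_le ⟨E, hE, rfl, rfl⟩

lemma genHammingWeight_anti {C C' : Submodule F (ι → F)} (h : C' ≤ C) {t : ℕ}
    (ht : t ≤ Module.finrank F C') : genHammingWeight C t ≤ genHammingWeight C' t := by
  obtain ⟨E, hE, rfl, hEw⟩ := exists_genHammingWeight_eq C' ht
  rw [← hEw]
  exact genHammingWeight_le (hE.trans h)

/-- A subcode of `C` of dimension `t + s` meets the codimension-`s` subspace `C'` in dimension at
least `t`, and passing to a subspace does not enlarge the support. -/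
lemma genHammingWeight_le_of_finrank_eq_add [Finite ι] {C C' : Submodule F (ι → F)} (h : C' ≤ C)
    {s t : ℕ} (hs : Module.finrank F C = Module.finrank F C' + s)
    (ht : t ≤ Module.finrank F C') : genHammingWeight C' t ≤ genHammingWeight C (t + s) := by
  obtain ⟨E, hE, hEt, hEw⟩ := exists_genHammingWeight_eq C (t := t + s) (by omega)
  have h1 := Submodule.finrank_sup_add_finrank_inf_eq E C'
  have h2 := Submodule.finrank_mono (sup_le hE h)
  obtain ⟨D, hD, rfl⟩ := exists_submodule_le_finrank_eq (E ⊓ C') (t := t) (by omega)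
  rw [← hEw]
  refine (genHammingWeight_le (hD.trans inf_le_right)).trans (Set.ncard_le_ncard ?_)
  rintro i ⟨v, hv, hvi⟩
  exact ⟨v, (hD hv).1, hvi⟩

end WeightLemmas

/-! ### Evaluation at rational places -/

section Evaluation

open IsDedekindDomain

variable {F K R : Type*} [Field F] [Field K] [Algebra F K] [CommRing R] [Algebra F R]
  [Algebra R K] [IsScalarTower F R K] (S : Set (Place F K))

/-- The evaluation of the elements of `R`, a ring of functions that are regular on `S`, at the
rational places of `S`. -/
def evalMap (hS : ∀ P ∈ S, ∀ r : R, P.val (algebraMap R K r) ≤ 1)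
    (hrat : ∀ P ∈ S, P.IsRational) : R →ₗ[F] (S → F) where
  toFun r P := (hrat P P.2 _ (hS P P.2 r)).choose
  map_add' r s := by
    funext P
    refine Place.HasValue.unique (hrat P P.2 _ (hS P P.2 (r + s))).choose_spec ?_
    have h := P.1.val.map_add_lt (hrat P P.2 _ (hS P P.2 r)).choose_spec
      (hrat P P.2 _ (hS P P.2 s)).choose_spec
    rwa [sub_add_sub_comm, ← map_add, ← map_add] at h
  map_smul' c r := by
    funext P
    refine Place.HasValue.unique (hrat P P.2 _ (hS P P.2 (c • r))).choose_spec ?_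
    have h := (P.1.val_smul_le c _).trans_lt (hrat P P.2 _ (hS P P.2 r)).choose_spec
    have h1 : algebraMap R K (c • r) = c • algebraMap R K r := by
      rw [Algebra.smul_def, map_mul, ← IsScalarTower.algebraMap_apply, ← Algebra.smul_def]
    rw [smul_sub, ← h1, Algebra.smul_def c (algebraMap F K _), ← map_mul] at h
    exact h

variable {S} (hS : ∀ P ∈ S, ∀ r : R, P.val (algebraMap R K r) ≤ 1)
    (hrat : ∀ P ∈ S, P.IsRational)

lemma hasValue_evalMap (r : R) (P : S) :
    P.1.HasValue (algebraMap R K r) (evalMap S hS hrat r P) :=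
  (hrat P P.2 _ (hS P P.2 r)).choose_spec

lemma evalMap_eq_of_hasValue {r : R} {w : S → F}
    (h : ∀ P : S, P.1.HasValue (algebraMap R K r) (w P)) : evalMap S hS hrat r = w :=
  funext fun P => (hasValue_evalMap hS hrat r P).unique (h P)

lemma evalCode_eq_map {W : Submodule F K}
    (hW : W ≤ LinearMap.range (IsScalarTower.toAlgHom F R K).toLinearMap) :
    evalCode S W =
      (W.comap (IsScalarTower.toAlgHom F R K).toLinearMap).map (evalMap S hS hrat) := by
  ext w
  constructor
  · rintro ⟨f, hf, hw⟩
    obtain ⟨r, rfl⟩ := hW hf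
    exact ⟨r, hf, evalMap_eq_of_hasValue hS hrat hw⟩
  · rintro ⟨r, hr, rfl⟩
    exact ⟨_, hr, hasValue_evalMap hS hrat r⟩

lemma nonempty_comap_equiv {M N : Type*} [AddCommGroup M] [Module F M] [AddCommGroup N]
    [Module F N] {φ : M →ₗ[F] N} (hφ : Function.Injective φ) {W : Submodule F N}
    (hW : W ≤ LinearMap.range φ) : Nonempty (W.comap φ ≃ₗ[F] W) :=
  ⟨(Submodule.equivMapOfInjective φ hφ _).trans
    (LinearEquiv.ofEq _ _ (Submodule.map_comap_eq_of_le hW))⟩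

/-- Distinct places have distinct centres, so the Chinese remainder theorem prescribes all values at
once. -/
lemma evalMap_surjective [Finite S] [IsDedekindDomain R] [IsFractionRing R K] :
    Function.Surjective (evalMap S hS hrat) := by
  have := Fintype.ofFinite S
  intro w
  obtain ⟨r, hr⟩ := IsDedekindDomain.exists_forall_sub_mem_ideal (s := (Finset.univ : Finset S))
    (fun P => (P.1.centre (hS P.1 P.2)).asIdeal) (fun _ => 1)
    (fun P _ => (P.1.centre (hS P.1 P.2)).prime)
    (fun P _ P' _ hne h => hne (Subtype.ext
      (Place.eq_of_centre_eq (hS P.1 P.2) (hS P'.1 P'.2) (HeightOneSpectrum.ext h))))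
    (fun P => algebraMap F R (w P))
  refine ⟨r, evalMap_eq_of_hasValue hS hrat fun P => ?_⟩
  have h := hr P (Finset.mem_univ _)
  rw [pow_one, Place.mem_centre, map_sub, ← IsScalarTower.algebraMap_apply] at h
  exact h

end Evaluation

/-! ### Injectivity of evaluation -/

section Curve

open IsDedekindDomain

variable {F : Type*} [Field F] {A B : F[X]} {a b : ℕ}

variable (A B) in
/-- The embedding of the coordinate ring in the function field. -/
def coordEmb : CoordRing A B →ₗ[F] FunctionField A B :=
  (IsScalarTower.toAlgHom F (CoordRing A B) (FunctionField A B)).toLinearMap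

lemma coordEmb_injective : Function.Injective (coordEmb A B) :=
  IsFractionRing.injective (CoordRing A B) (FunctionField A B)

variable [Fact (AbsIrreducible A B)] {Q : Place F (FunctionField A B)}

lemma riemannSpace_le_range [IsDedekindDomain (CoordRing A B)] (hb0 : 0 < b)
    (hQ : PoleWeights a b Q 1) (m : ℕ) :
    riemannSpace (Finsupp.single Q (m : ℤ)) ≤ LinearMap.range (coordEmb A B) := fun f hf =>
  exists_eq_of_regular hQ hb0 ((mem_riemannSpace_single m f).mp hf).2

/-- A nonzero function with no pole outside `Q` has at most as many rational zeros as its pole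
order at `Q`. -/
lemma ncard_le_of_evalMap_eq_zero [Finite F] (ha : A.natDegree = a) (hb : B.natDegree = b)
    (ha0 : 0 < a) (hb0 : 0 < b) (hab : Nat.Coprime a b) [IsDedekindDomain (CoordRing A B)]
    (hQ : PoleWeights a b Q 1) {S : Set (Place F (FunctionField A B))} [Finite S]
    (hS : ∀ P ∈ S, ∀ r : CoordRing A B, P.val (algebraMap _ (FunctionField A B) r) ≤ 1)
    (hrat : ∀ P ∈ S, P.IsRational) {r : CoordRing A B} (hr : r ≠ 0) {m : ℕ}
    (hrm : Q.val (algebraMap _ (FunctionField A B) r) ≤ WithZero.exp (m : ℤ))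
    (hr0 : evalMap S hS hrat r = 0) : S.ncard ≤ m := by
  have := Fintype.ofFinite S
  set L : ℕ → Submodule F (CoordRing A B) := fun N =>
    (riemannSpace (Finsupp.single Q (N : ℤ))).comap (coordEmb A B) with hL
  have memL (N : ℕ) (s : CoordRing A B) :
      s ∈ L N ↔ Q.val (algebraMap _ (FunctionField A B) s) ≤ WithZero.exp (N : ℤ) :=
    (mem_riemannSpace_single N _).trans
      ⟨fun h => h.1, fun h => ⟨h, fun P hP => hQ.val_le_one ha hb ha0 hb0 hab hP s⟩⟩
  have hequiv (N : ℕ) := nonempty_comap_equiv (coordEmb_injective (A := A) (B := B))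
    (riemannSpace_le_range hb0 hQ N)
  have hspan := riemannSpace_eq_span ha hb ha0 hb0 hab hQ
  have hfd (N : ℕ) : FiniteDimensional F (L N) := by
    have h1 : FiniteDimensional F (riemannSpace (Finsupp.single Q (N : ℤ))) := by
      rw [hspan]
      exact FiniteDimensional.span_of_finite F ((finite_weight_le hab N).image _)
    exact Module.Finite.equiv (hequiv N).some.symm
  have hrank (N : ℕ) : Module.finrank F (L N) = {k : Fin b × ℕ | weight a b k ≤ N}.ncard := by
    rw [(hequiv N).some.finrank_eq, hspan,
      finrank_span_image (hQ.linearIndependent_monoFun hab) (finite_weight_le hab N)]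
  -- There are finitely many words, as `F` and `S` are finite, so one bound `N` serves for preimages
  -- of all of them.
  obtain ⟨N, hN⟩ : ∃ N : ℕ, (L N).map (evalMap S hS hrat) = ⊤ := by
    have hex (s : CoordRing A B) : ∃ N : ℕ, s ∈ L N := by
      by_cases hs : s = 0
      · exact ⟨0, by rw [hs]; exact Submodule.zero_mem _⟩
      · refine ⟨(Q.poleOrder (algebraMap _ (FunctionField A B) s)).toNat, ?_⟩
        rw [memL, ← WithZero.exp_log (show Q.val (algebraMap _ (FunctionField A B) s) ≠ 0 by
          simpa using hs), WithZero.exp_le_exp]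
        exact Int.self_le_toNat _
    choose g hg using evalMap_surjective hS hrat
    choose d hd using hex
    obtain ⟨N, hN⟩ := (Set.finite_range fun w => d (g w)).bddAbove
    refine ⟨N, eq_top_iff.mpr fun w _ => ⟨g w, ?_, hg w⟩⟩
    refine (memL _ _).mpr (((memL _ _).mp (hd (g w))).trans ?_)
    rw [WithZero.exp_le_exp]
    exact_mod_cast hN ⟨w, rfl⟩
  set ev := (evalMap S hS hrat).domRestrict (L (N + m)) with hev
  have hsurj : LinearMap.range ev = ⊤ := by
    rw [LinearMap.range_domRestrict, eq_top_iff, ← hN]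
    refine Submodule.map_mono fun s hs => (memL _ _).mpr (((memL _ _).mp hs).trans ?_)
    rw [WithZero.exp_le_exp]
    push_cast
    omega
  have hmul (s : L N) : r * s ∈ L (N + m) := by
    rw [memL, map_mul, map_mul]
    refine (mul_le_mul' hrm ((memL _ _).mp s.2)).trans ?_
    rw [← WithZero.exp_add, WithZero.exp_le_exp]
    push_cast
    omega
  have hker (s : L N) : (⟨r * s, hmul s⟩ : L (N + m)) ∈ LinearMap.ker ev := by
    rw [LinearMap.mem_ker]
    change evalMap S hS hrat (r * s) = 0
    refine evalMap_eq_of_hasValue hS hrat fun P => ?_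
    have h1 := hasValue_evalMap hS hrat r P
    rw [hr0] at h1
    simp only [Place.HasValue, Pi.zero_apply, map_zero, sub_zero] at h1 ⊢
    rw [map_mul, map_mul]
    exact mul_lt_one_of_lt_of_le h1 (hS P P.2 _)
  let φ : L N →ₗ[F] LinearMap.ker ev :=
    (((LinearMap.mulLeft F r).domRestrict (L N)).codRestrict (L (N + m)) hmul).codRestrict _ hker
  have hφ : Function.Injective φ := by
    intro s s' h
    have h1 : r * (s : CoordRing A B) = r * s' :=
      congrArg (fun u : LinearMap.ker ev => ((u : L (N + m)) : CoordRing A B)) h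
    exact Subtype.ext (mul_left_cancel₀ hr h1)
  have h1 := LinearMap.finrank_le_finrank_of_injective hφ
  have h2 := ev.finrank_range_add_finrank_ker
  rw [hsurj, finrank_top, Module.finrank_fintype_fun_eq_card, hrank] at h2
  rw [hrank] at h1
  -- With `w(N)` the number of weights up to `N`: `w(N) ≤ dim ker = w(N + m) - #S ≤ w(N) + m - #S`.
  have h3 := ncard_weight_le_add_le (b := b) hab N m
  rw [← Nat.card_coe_set_eq, Nat.card_eq_fintype_card]
  omega

/-- Evaluation preserves the dimension of a space of functions whose pole order at `Q` is less than
the number of points. -/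
lemma finrank_evalCode [Finite F] (ha : A.natDegree = a) (hb : B.natDegree = b)
    (ha0 : 0 < a) (hb0 : 0 < b) (hab : Nat.Coprime a b) [IsDedekindDomain (CoordRing A B)]
    (hQ : PoleWeights a b Q 1) {S : Set (Place F (FunctionField A B))} [Finite S]
    (hSQ : ∀ P ∈ S, P ≠ Q) (hrat : ∀ P ∈ S, P.IsRational) {m : ℕ} (hm : m < S.ncard)
    {W : Submodule F (FunctionField A B)} (hW : W ≤ riemannSpace (Finsupp.single Q (m : ℤ))) :
    Module.finrank F (evalCode S W) = Module.finrank F W := by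
  have hS (P) (hP : P ∈ S) (r : CoordRing A B) : P.val (algebraMap _ (FunctionField A B) r) ≤ 1 :=
    hQ.val_le_one ha hb ha0 hb0 hab (hSQ P hP) r
  have hWr := hW.trans (riemannSpace_le_range hb0 hQ m)
  rw [evalCode_eq_map hS hrat hWr, ← LinearMap.range_domRestrict, LinearMap.finrank_range_of_inj,
    ← coordEmb, (nonempty_comap_equiv coordEmb_injective hWr).some.finrank_eq]
  rw [← LinearMap.ker_eq_bot, LinearMap.ker_eq_bot']
  rintro ⟨r, hr⟩ h
  by_contra hne
  have hr0 : r ≠ 0 := fun h0 => hne (Subtype.ext h0)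
  exact absurd (ncard_le_of_evalMap_eq_zero ha hb ha0 hb0 hab hQ hS hrat hr0
    ((mem_riemannSpace_single m _).mp (hW hr)).1 h) (not_le.mpr hm)

end Curve

end SepCurve

end

/-! ### The proposition -/

open SepCurve in
theorem mainTheorem6 {F : Type*} [Field F] [Finite F] (A B : F[X]) (a b : ℕ)
    (ha : A.natDegree = a) (hb : B.natDegree = b) (ha0 : 0 < a) (hb0 : 0 < b)
    (hab : Nat.Coprime a b) [Fact (AbsIrreducible A B)]
    (Q : Place F (FunctionField A B)) (hQx : Q.IsPole (xFun A B)) (hQy : Q.IsPole (yFun A B))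
    (hH : weierstrassSemigroup Q = (AddSubmonoid.closure {a, b} : AddSubmonoid ℕ))
    (m : ℕ) (hm : m < (evalPoints A B).ncard)
    (V : Submodule F (FunctionField A B)) (hV : V = completeSpace A B Q m)
    (t : ℕ) (ht1 : 1 ≤ t) (htk : t ≤ Module.finrank F (evalCode (evalPoints A B) V)) :
    (m < a * (b - 1) →
      genHammingWeight (evalCode (evalPoints A B) V) t =
        genHammingWeight
          (evalCode (evalPoints A B) (riemannSpace (Finsupp.single Q (m : ℤ)))) t) ∧
    (a * (b - 1) ≤ m →
      genHammingWeight
          (evalCode (evalPoints A B) (riemannSpace (Finsupp.single Q (m : ℤ)))) t ≤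
        genHammingWeight (evalCode (evalPoints A B) V) t ∧
      genHammingWeight (evalCode (evalPoints A B) V) t ≤
        genHammingWeight
          (evalCode (evalPoints A B) (riemannSpace (Finsupp.single Q (m : ℤ))))
          (t + (m - a * (b - 1)) / b + 1)) := by
  obtain ⟨e, hQ⟩ := exists_poleWeights ha hb ha0 hb0 hab Q (Or.inl hQx)
  obtain rfl := hQ.eq_one hb hb0 hab
  have := isDedekindDomain_coordRing ha hb ha0 hb0 hab hQ hH
  -- An infinite set has `ncard` zero, which `m < n` excludes.
  have hfin : Finite (evalPoints A B) := Set.finite_of_ncard_pos (by omega)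
  have hrat : ∀ P ∈ evalPoints A B, P.IsRational := by
    intro P hP
    obtain ⟨β, hβ, hP⟩ := Set.mem_iUnion₂.mp hP
    exact hβ.2 P hP
  have hne : ∀ P ∈ evalPoints A B, P ≠ Q := by
    rintro P hP rfl
    obtain ⟨β, -, hβ⟩ := Set.mem_iUnion₂.mp hP
    have h := P.val.map_add (yFun A B - algebraMap F _ β) (algebraMap F _ β)
    rw [sub_add_cancel] at h
    exact absurd hQy (not_lt.mpr (h.trans (max_le (le_of_lt hβ) (P.val_algebraMap_le_one β))))
  have hLI := hQ.linearIndependent_monoFun hab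
  have hL := riemannSpace_eq_span ha hb ha0 hb0 hab hQ m
  have hVL : V ≤ riemannSpace (Finsupp.single Q (m : ℤ)) := hV.trans_le inf_le_left
  have hVs : V = Submodule.span F
      (monoFun A B b '' ({k | weight a b k ≤ m} ∩ {k | (k.1 : ℕ) < b - 1})) := by
    rw [hV, completeSpace, hL, polySpace_eq_span hb, span_image_inf_span_image hLI]
  constructor
  · intro hlt
    have hset : {k : Fin b × ℕ | weight a b k ≤ m} ∩ {k | (k.1 : ℕ) < b - 1} =
        {k | weight a b k ≤ m} := by
      -- A weight at most `m < a * (b - 1)` forces `a * i < a * (b - 1)`.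
      refine Set.inter_eq_left.mpr fun k hk => ?_
      have h1 : a * k.1 ≤ weight a b k := Nat.le_add_right _ _
      exact lt_of_mul_lt_mul_left ((h1.trans hk).trans_lt hlt) (Nat.zero_le a)
    rw [hVs, hset, ← hL]
  · intro hge
    have hC : evalCode (evalPoints A B) V ≤
        evalCode (evalPoints A B) (riemannSpace (Finsupp.single Q (m : ℤ))) := by
      rintro w ⟨f, hf, hw⟩
      exact ⟨f, hVL hf, hw⟩
    refine ⟨genHammingWeight_anti hC htk, ?_⟩
    rw [add_assoc]
    refine genHammingWeight_le_of_finrank_eq_add hC ?_ htk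
    rw [finrank_evalCode ha hb ha0 hb0 hab hQ hne hrat hm le_rfl,
      finrank_evalCode ha hb ha0 hb0 hab hQ hne hrat hm hVL, hL, hVs,
      finrank_span_image hLI (finite_weight_le hab m),
      finrank_span_image hLI ((finite_weight_le hab m).inter_of_left _),
      ncard_weight_le_eq hab hb0 hge]
    rfl
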